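/- Let $P_u(x)=\dfrac{u}{\pi(u^2+x^2)}$ ($u>0$, $x\in\mathbb R$) be the Poisson kernel of the upper half plane, let $M(\mathbb R)$ be the space of complex (hence finite) Borel measures on $\mathbb R$, with the total variation norm $\|\mu\|=|\mu|(\mathbb R)$, and let $F$ be a complex-valued harmonic function on the upper half plane $\{x+iu : x\in\mathbb R,\ u>0\}$. Put $A_u=\int_{\mathbb R}|F(x+iu)|\,dx\in[0,\infty]$ for $u>0$. Then there is a unique measure $\mu\in M(\mathbb R)$ such that $$F(x+iu)=\int_{\mathbb R}P_u(x-t)\,d\mu(t)\qquad\text{for all }x\in\mathbb R,\ u>0,$$ if and only if there is a constant $K<\infty$ such that $A_u\le K$ for all $u>0$. A measure $\mu\in M(\mathbb R)$ with this representation is unique whenever it exists, and it satisfies $\|\mu\|=\lim_{u\downarrow 0}A_u$. -/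

import Mathlib

open MeasureTheory Filter Topology
open scoped ENNReal NNReal

/-- The Poisson kernel of the upper half plane, `P_u(x) = u / (π (u² + x²))`, used for `u > 0`. -/
noncomputable def halfPlanePoissonKernel (u x : ℝ) : ℝ :=
  u / (Real.pi * (u ^ 2 + x ^ 2))

/-- `F` is the Poisson integral of the complex Borel measure `μ` in the upper half plane:
`F (x + i u) = ∫ P_u(x - t) dμ(t)` for all real `x` and all `u > 0`.
(A complex measure has finite total variation and `P_u` is bounded and continuous, so that the
integral exists.) -/
def IsPoissonIntegralOf (F : ℂ → ℂ) (μ : ComplexMeasure ℝ) : Prop :=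
  ∀ x u : ℝ, 0 < u →
    F (x + u * Complex.I) = ∫ᵛ t, halfPlanePoissonKernel u (x - t) ∂•μ

/-- `A_u = ∫ |F(x + i u)| dx`, the `L¹` norm of `F` at height `u`, as an element of `[0, ∞]`. -/
noncomputable def heightL1Norm (F : ℂ → ℂ) (u : ℝ) : ℝ≥0∞ :=
  ∫⁻ x : ℝ, ‖F (x + u * Complex.I)‖ₑ

/-!
The Poisson kernels `P_u` form an approximate identity as `u → 0`, and they are the reproducing
kernels of the upper half plane; the theorem combines the two facts.

*From the measure to the norms.* By Radon–Nikodym a complex measure is `h • ρ` with `ρ` finite and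
positive and `h ∈ L¹(ρ)`, and its total variation norm is `∫ |h| dρ`. Since `P_u` has mass `1`,
Tonelli's theorem gives `A_u ≤ ‖μ‖` (`IsPoissonIntegralOf.heightL1Norm_le`). For a continuous `φ`
bounded by `1`, Fubini's theorem and dominated convergence give `∫ φ(x) F(x + iu) dx → ∫ φ dμ`
(`IsPoissonIntegralOf.tendsto_integral_mul`), and `‖μ‖` is the supremum of `|∫ φ dμ|`. Hence
`A_u → ‖μ‖` (`IsPoissonIntegralOf.tendsto_heightL1Norm`), and uniqueness follows by applying this to
the difference of two representing measures, which represents `0`.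

*From the norms to the measure.* Let `A_u ≤ K`. The mean value property over discs bounds `F` by a
multiple of `K / δ` above height `δ` (`HarmonicOnNhd.norm_le_of_heightL1Norm_le`). A bounded harmonic
function there is the Poisson integral of its values at height `δ`: in the Poisson formula for the
disc of radius `R` which touches the line at height `δ`, the circle, parametrized by arc length,
tends to the line as `R → ∞`, and dominated convergence applies
(`HarmonicOnNhd.eq_integral_halfPlanePoissonKernel_smul`). So
`F(x + i(u + δ)) = ∫ P_u(x - t) F(t + iδ) dt`, where the measures `F(t + iδ) dt` have norm at
most `K`. They need not be tight, but `P_u(x - t) = O((1 + t²)⁻¹)`, and multiplied by `(1 + t²)⁻¹`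
they are tight. Prokhorov's theorem provides a weak limit as `δ → 0`
(`exists_complexMeasure_tendsto_integral_smul`), which represents `F`.
-/

/-! ### Complex measures as densities -/

/-- Radon–Nikodym: a complex measure is `h • ρ` for a finite positive measure `ρ` and `h ∈ L¹(ρ)`. -/
theorem MeasureTheory.ComplexMeasure.exists_eq_withDensityᵥ {α : Type*} [MeasurableSpace α]
    (c : ComplexMeasure α) :
    ∃ (ρ : Measure α) (h : α → ℂ), IsFiniteMeasure ρ ∧ Integrable h ρ ∧ c = ρ.withDensityᵥ h := by
  set ρ : Measure α :=
    (ComplexMeasure.re c).totalVariation + (ComplexMeasure.im c).totalVariation with hρ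
  have hfin (s : SignedMeasure α) : IsFiniteMeasure s.totalVariation := by
    unfold SignedMeasure.totalVariation; infer_instance
  have : IsFiniteMeasure ρ := by infer_instance
  have key (s : SignedMeasure α) (hs : s.totalVariation ≤ ρ) :
      ρ.withDensityᵥ (s.rnDeriv ρ) = s := by
    apply SignedMeasure.withDensityᵥ_rnDeriv_eq
    rw [SignedMeasure.absolutelyContinuous_ennreal_iff]
    have h2 : ρ.toENNRealVectorMeasure.ennrealToMeasure = ρ :=
      VectorMeasure.equivMeasure.right_inv ρ
    rw [h2]
    exact Measure.absolutelyContinuous_of_le hs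
  have h1 := key (ComplexMeasure.re c) (Measure.le_add_right le_rfl)
  have h2 := key (ComplexMeasure.im c) (Measure.le_add_left le_rfl)
  refine ⟨ρ, c.rnDeriv ρ, this, c.integrable_rnDeriv ρ, ?_⟩
  have hint := c.integrable_rnDeriv ρ
  ext s hs
  rw [withDensityᵥ_apply hint hs]
  apply Complex.ext
  · have : (c s).re = (ComplexMeasure.re c) s := rfl
    rw [this, ← h1, withDensityᵥ_apply (SignedMeasure.integrable_rnDeriv _ _) hs]
    exact (integral_re hint.integrableOn).trans rfl
  · have : (c s).im = (ComplexMeasure.im c) s := rfl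
    rw [this, ← h2, withDensityᵥ_apply (SignedMeasure.integrable_rnDeriv _ _) hs]
    exact (integral_im hint.integrableOn).trans rfl

theorem MeasureTheory.Measure.variation_withDensityᵥ_univ {α : Type*} [MeasurableSpace α]
    {ρ : Measure α} {h : α → ℂ} (hh : Integrable h ρ) :
    (ρ.withDensityᵥ h).variation Set.univ = ∫⁻ t, ‖h t‖ₑ ∂ρ := by
  rw [Measure.variation_withDensityᵥ hh, withDensity_apply _ MeasurableSet.univ,
    Measure.restrict_univ]

instance MeasureTheory.ComplexMeasure.isFiniteMeasure_variation {α : Type*} [MeasurableSpace α]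
    (c : ComplexMeasure α) : IsFiniteMeasure (VectorMeasure.variation c) := by
  obtain ⟨ρ, h, _, hh, rfl⟩ := c.exists_eq_withDensityᵥ
  exact ⟨by rw [Measure.variation_withDensityᵥ_univ hh]; exact hh.2⟩

/-- Integration of a bounded real function against the complex measure `h • ρ`. -/
theorem MeasureTheory.VectorMeasure.integral_withDensityᵥ {α : Type*} [MeasurableSpace α]
    {ρ : Measure α} {h : α → ℂ} (hh : Integrable h ρ) {f : α → ℝ} (hf : Measurable f)
    {C : ℝ} (hC : ∀ t, ‖f t‖ ≤ C) :
    ∫ᵛ t, f t ∂•(ρ.withDensityᵥ h) = ∫ t, f t • h t ∂ρ := by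
  have hfin : IsFiniteMeasure (ρ.withDensityᵥ h).variation :=
    ComplexMeasure.isFiniteMeasure_variation _
  have hs_int (g : SimpleFunc α ℝ) : Integrable (fun t => g t • h t) ρ := by
    obtain ⟨B, hB⟩ := g.exists_forall_norm_le
    exact hh.bdd_smul B g.measurable.aestronglyMeasurable (.of_forall hB)
  have hsimple (g : SimpleFunc α ℝ) :
      ∫ᵛ t, g t ∂•(ρ.withDensityᵥ h) = ∫ t, g t • h t ∂ρ := by
    induction g using SimpleFunc.induction with
    | const c hs =>
      rename_i s
      simp only [SimpleFunc.coe_piecewise, SimpleFunc.coe_const,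
        Set.piecewise_eq_indicator, SimpleFunc.const_zero, SimpleFunc.coe_zero]
      have : (Function.const α c) = fun _ => c := rfl
      rw [this, VectorMeasure.integral_indicator_const c hs]
      simp only [ContinuousLinearMap.lsmul_apply]
      rw [withDensityᵥ_apply hh hs, ← MeasureTheory.integral_smul,
        ← MeasureTheory.integral_indicator hs]
      congr with t
      by_cases ht : t ∈ s <;> simp [ht]
    | add hd hf hg =>
      rename_i f g
      have hi (g : SimpleFunc α ℝ) : (ρ.withDensityᵥ h).Integrable g :=
        g.integrable_of_isFiniteMeasure
      simp only [SimpleFunc.coe_add, Pi.add_apply]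
      rw [VectorMeasure.integral_fun_add (hi f) (hi g), hf, hg,
        ← MeasureTheory.integral_add (hs_int f) (hs_int g)]
      simp only [add_smul]
  set g : ℕ → SimpleFunc α ℝ := fun n => SimpleFunc.approxOn f hf Set.univ 0 trivial n with hg
  have hbd (n : ℕ) (t : α) : ‖g n t‖ ≤ C + C :=
    (SimpleFunc.norm_approxOn_zero_le hf (Set.mem_univ _) t n).trans (add_le_add (hC t) (hC t))
  have hlim (t : α) : Tendsto (fun n => g n t) atTop (𝓝 (f t)) :=
    SimpleFunc.tendsto_approxOn hf (Set.mem_univ _) (by simp)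
  have h1 : Tendsto (fun n => ∫ᵛ t, g n t ∂•(ρ.withDensityᵥ h)) atTop
      (𝓝 (∫ᵛ t, f t ∂•(ρ.withDensityᵥ h))) :=
    VectorMeasure.tendsto_integral_filter_of_norm_le_const
      (.of_forall fun n => (g n).measurable.aestronglyMeasurable)
      ⟨C + C, .of_forall fun n => .of_forall (hbd n)⟩ (.of_forall hlim)
  have h2 : Tendsto (fun n => ∫ t, g n t • h t ∂ρ) atTop (𝓝 (∫ t, f t • h t ∂ρ)) := by
    refine MeasureTheory.tendsto_integral_of_dominated_convergence (fun t => (C + C) * ‖h t‖)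
      (fun n => (hs_int (g n)).1) (hh.norm.const_mul _) (fun n => .of_forall fun t => ?_)
      (.of_forall fun t => (hlim t).smul_const _)
    rw [norm_smul]
    exact mul_le_mul_of_nonneg_right (hbd n t) (norm_nonneg _)
  simp only [hsimple] at h1
  exact tendsto_nhds_unique h1 h2

/-- The `L¹(ρ)` norm of `h` is approached by integrals of `h` against continuous functions bounded
by `1`. -/
theorem MeasureTheory.Integrable.exists_continuous_lt_norm_integral_mul {ρ : Measure ℝ}
    [IsFiniteMeasure ρ] {h : ℝ → ℂ} (hh : Integrable h ρ) {a : ℝ} (ha : a < ∫ t, ‖h t‖ ∂ρ) :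
    ∃ φ : ℝ → ℂ, Continuous φ ∧ (∀ t, ‖φ t‖ ≤ 1) ∧ a < ‖∫ t, φ t * h t ∂ρ‖ := by
  set ε := ((∫ t, ‖h t‖ ∂ρ) - a) / 4 with hε
  have hε0 : 0 < ε := by simp only [hε]; linarith
  obtain ⟨g, hg, hgi⟩ := hh.exists_boundedContinuous_integral_sub_le hε0
  set η := ε / (ρ.real Set.univ + 1) with hη
  have hη0 : 0 < η := by positivity
  have hηρ : η * ρ.real Set.univ ≤ ε := by
    rw [hη, div_mul_eq_mul_div, div_le_iff₀ (by positivity)]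
    nlinarith
  -- `φ` is the continuous substitute for the phase `conj g / |g|`
  set φ : ℝ → ℂ := fun t => ((‖g t‖ + η)⁻¹ : ℝ) * (starRingEnd ℂ) (g t) with hφ
  have hden (t : ℝ) : 0 < ‖g t‖ + η := by positivity
  have hφc : Continuous φ := by
    refine (Complex.continuous_ofReal.comp
      ((g.continuous.norm.add continuous_const).inv₀ fun t => (hden t).ne')).mul
      (Complex.continuous_conj.comp g.continuous)
  have hφ1 (t : ℝ) : ‖φ t‖ ≤ 1 := by
    simp only [hφ, norm_mul, Complex.norm_real, RCLike.norm_conj, norm_inv, Real.norm_eq_abs,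
      abs_of_pos (hden t)]
    rw [inv_mul_le_one₀ (hden t)]; linarith
  refine ⟨φ, hφc, hφ1, ?_⟩
  have hφh : Integrable (fun t => φ t * h t) ρ :=
    hh.bdd_mul (c := 1) hφc.aestronglyMeasurable (.of_forall hφ1)
  have hφg : Integrable (fun t => φ t * g t) ρ :=
    hgi.bdd_mul (c := 1) hφc.aestronglyMeasurable (.of_forall hφ1)
  have hre (t : ℝ) : ‖g t‖ - η ≤ (φ t * g t).re := by
    have : φ t * g t = (((‖g t‖ + η)⁻¹ * ‖g t‖ ^ 2 : ℝ) : ℂ) := by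
      simp only [hφ]
      rw [mul_assoc, mul_comm ((starRingEnd ℂ) (g t)), Complex.mul_conj, Complex.normSq_eq_norm_sq]
      push_cast; ring
    rw [this, Complex.ofReal_re, inv_mul_eq_div, le_div_iff₀ (hden t)]
    nlinarith
  have h1 : (∫ t, ‖g t‖ ∂ρ) - η * ρ.real Set.univ ≤ ‖∫ t, φ t * g t ∂ρ‖ := by
    calc (∫ t, ‖g t‖ ∂ρ) - η * ρ.real Set.univ = ∫ t, (‖g t‖ - η) ∂ρ := by
          rw [integral_sub hgi.norm (integrable_const _)]; simp [mul_comm]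
      _ ≤ ∫ t, (φ t * g t).re ∂ρ :=
          integral_mono (hgi.norm.sub (integrable_const _)) hφg.re hre
      _ = (∫ t, φ t * g t ∂ρ).re := integral_re hφg
      _ ≤ _ := Complex.re_le_norm _
  have h2 : ‖(∫ t, φ t * g t ∂ρ) - ∫ t, φ t * h t ∂ρ‖ ≤ ε := by
    rw [← integral_sub hφg hφh]
    refine (norm_integral_le_integral_norm _).trans (le_trans ?_ hg)
    refine integral_mono (hφg.sub hφh).norm (hh.sub hgi).norm fun t => ?_
    rw [← mul_sub, norm_mul, norm_sub_rev]
    exact mul_le_of_le_one_left (norm_nonneg _) (hφ1 t)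
  have h3 : (∫ t, ‖h t‖ ∂ρ) ≤ (∫ t, ‖g t‖ ∂ρ) + ε := by
    have : (∫ t, ‖h t‖ ∂ρ) - ∫ t, ‖g t‖ ∂ρ ≤ ∫ t, ‖h t - g t‖ ∂ρ := by
      rw [← integral_sub hh.norm hgi.norm]
      exact integral_mono (hh.norm.sub hgi.norm) (hh.sub hgi).norm
        fun t => norm_sub_norm_le _ _
    linarith
  have h4 := norm_sub_norm_le (∫ t, φ t * g t ∂ρ) (∫ t, φ t * h t ∂ρ)
  have : a = (∫ t, ‖h t‖ ∂ρ) - 4 * ε := by simp only [hε]; ring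
  linarith

/-! ### The Poisson kernel as an approximate identity -/

theorem halfPlanePoissonKernel_nonneg {u : ℝ} (hu : 0 < u) (x : ℝ) :
    0 ≤ halfPlanePoissonKernel u x := by
  unfold halfPlanePoissonKernel; positivity

theorem halfPlanePoissonKernel_le {u : ℝ} (hu : 0 < u) (x : ℝ) :
    halfPlanePoissonKernel u x ≤ 1 / (Real.pi * u) := by
  unfold halfPlanePoissonKernel
  rw [div_le_div_iff₀ (by positivity) (by positivity)]
  nlinarith [Real.pi_pos, mul_nonneg Real.pi_pos.le (sq_nonneg x)]

theorem norm_halfPlanePoissonKernel_le {u : ℝ} (hu : 0 < u) (x : ℝ) :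
    ‖halfPlanePoissonKernel u x‖ ≤ 1 / (Real.pi * u) := by
  rw [Real.norm_of_nonneg (halfPlanePoissonKernel_nonneg hu x)]
  exact halfPlanePoissonKernel_le hu x

theorem continuous_halfPlanePoissonKernel {u : ℝ} (hu : 0 < u) :
    Continuous (halfPlanePoissonKernel u) := by
  unfold halfPlanePoissonKernel
  exact continuous_const.div (by fun_prop) fun x => by positivity

theorem halfPlanePoissonKernel_eq_cauchyPDFReal (t : ℝ) {u : ℝ} (hu : 0 < u) (x : ℝ) :
    halfPlanePoissonKernel u (x - t) = ProbabilityTheory.cauchyPDFReal t (NNReal.mk u hu.le) x := by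
  rw [ProbabilityTheory.cauchyPDFReal_def, halfPlanePoissonKernel]
  simp only [NNReal.coe_mk, mul_inv, div_eq_mul_inv]
  rw [add_comm (u ^ 2)]
  ring

theorem integrable_halfPlanePoissonKernel (t : ℝ) {u : ℝ} (hu : 0 < u) :
    Integrable fun x => halfPlanePoissonKernel u (x - t) := by
  simp only [halfPlanePoissonKernel_eq_cauchyPDFReal t hu]
  exact ProbabilityTheory.integrable_cauchyPDFReal _

theorem integral_halfPlanePoissonKernel (t : ℝ) {u : ℝ} (hu : 0 < u) :
    ∫ x, halfPlanePoissonKernel u (x - t) = 1 := by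
  simp only [halfPlanePoissonKernel_eq_cauchyPDFReal t hu]
  refine ProbabilityTheory.integral_cauchyPDFReal_eq_one _ ?_
  rw [← NNReal.coe_ne_zero]
  exact hu.ne'

theorem lintegral_halfPlanePoissonKernel (t : ℝ) {u : ℝ} (hu : 0 < u) :
    ∫⁻ x, ‖halfPlanePoissonKernel u (x - t)‖ₑ = 1 := by
  have h := integral_halfPlanePoissonKernel t hu
  rw [integral_eq_lintegral_of_nonneg_ae (.of_forall fun x => halfPlanePoissonKernel_nonneg hu _)
    (integrable_halfPlanePoissonKernel t hu).1] at h
  rw [ENNReal.toReal_eq_one_iff] at h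
  rw [← h]
  congr with x
  rw [Real.enorm_of_nonneg (halfPlanePoissonKernel_nonneg hu _)]

theorem norm_integral_halfPlanePoissonKernel_smul_le {u : ℝ} (hu : 0 < u) {φ : ℝ → ℂ}
    (hφ1 : ∀ t, ‖φ t‖ ≤ 1) (t : ℝ) :
    ‖∫ x, halfPlanePoissonKernel u (x - t) • φ x‖ ≤ 1 := by
  rw [← integral_halfPlanePoissonKernel t hu]
  refine norm_integral_le_of_norm_le (integrable_halfPlanePoissonKernel t hu)
    (.of_forall fun x => ?_)
  rw [norm_smul, Real.norm_of_nonneg (halfPlanePoissonKernel_nonneg hu _)]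
  exact mul_le_of_le_one_right (halfPlanePoissonKernel_nonneg hu _) (hφ1 x)

/-- The Poisson kernels are dilates of each other. -/
theorem integral_halfPlanePoissonKernel_smul_eq {u : ℝ} (hu : 0 < u) (φ : ℝ → ℂ) (t : ℝ) :
    ∫ x, halfPlanePoissonKernel u (x - t) • φ x =
      ∫ y, halfPlanePoissonKernel 1 y • φ (t + u * y) := by
  have h1 : ∫ x, halfPlanePoissonKernel u (x - t) • φ x =
      ∫ z, halfPlanePoissonKernel u z • φ (t + z) := by
    rw [← integral_add_left_eq_self _ t]
    simp
  have h2 := Measure.integral_comp_mul_left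
    (fun z => halfPlanePoissonKernel u z • φ (t + z)) u
  rw [abs_of_pos (inv_pos.2 hu)] at h2
  have h3 : ∫ z, halfPlanePoissonKernel u z • φ (t + z) =
      u • ∫ y, halfPlanePoissonKernel u (u * y) • φ (t + u * y) := by
    rw [h2, smul_smul, mul_inv_cancel₀ hu.ne', one_smul]
  rw [h1, h3, ← integral_smul]
  congr with y
  rw [smul_smul]
  congr 1
  unfold halfPlanePoissonKernel
  field_simp

theorem tendsto_integral_halfPlanePoissonKernel_smul {φ : ℝ → ℂ} (hφ : Continuous φ)
    (hφ1 : ∀ t, ‖φ t‖ ≤ 1) (t : ℝ) :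
    Tendsto (fun u => ∫ x, halfPlanePoissonKernel u (x - t) • φ x) (𝓝[>] 0) (𝓝 (φ t)) := by
  have hint : Integrable fun y => halfPlanePoissonKernel 1 y := by
    simpa using integrable_halfPlanePoissonKernel 0 one_pos
  have h1 : ∫ y, halfPlanePoissonKernel 1 y • φ (t + 0 * y) = φ t := by
    simp only [zero_mul, add_zero]
    rw [integral_smul_const]
    have := integral_halfPlanePoissonKernel 0 one_pos
    simp only [sub_zero] at this
    rw [this, one_smul]
  have h2 : Tendsto (fun u => ∫ y, halfPlanePoissonKernel 1 y • φ (t + u * y)) (𝓝[>] 0)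
      (𝓝 (∫ y, halfPlanePoissonKernel 1 y • φ (t + 0 * y))) := by
    refine tendsto_integral_filter_of_dominated_convergence
      (fun y => halfPlanePoissonKernel 1 y) (.of_forall fun u => ?_)
      (.of_forall fun u => .of_forall fun y => ?_) hint (.of_forall fun y => ?_)
    · have : Continuous fun y => φ (t + u * y) := hφ.comp (by fun_prop)
      exact ((continuous_halfPlanePoissonKernel one_pos).smul this).aestronglyMeasurable
    · rw [norm_smul, Real.norm_of_nonneg (halfPlanePoissonKernel_nonneg one_pos _)]
      exact mul_le_of_le_one_right (halfPlanePoissonKernel_nonneg one_pos _) (hφ1 _)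
    · have hφy : Continuous fun u : ℝ => φ (t + u * y) := hφ.comp (by fun_prop)
      exact ((hφy.tendsto 0).mono_left nhdsWithin_le_nhds).const_smul _
  rw [h1] at h2
  refine h2.congr' ?_
  filter_upwards [self_mem_nhdsWithin] with u hu
  rw [integral_halfPlanePoissonKernel_smul_eq hu]

/-! ### Poisson integrals of a complex measure -/

theorem MeasureTheory.VectorMeasure.integrable_halfPlanePoissonKernel (μ : ComplexMeasure ℝ)
    (x : ℝ) {u : ℝ} (hu : 0 < u) :
    VectorMeasure.Integrable μ fun t => halfPlanePoissonKernel u (x - t) :=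
  Integrable.of_bound (C := 1 / (Real.pi * u))
    ((continuous_halfPlanePoissonKernel hu).comp (by fun_prop)).aestronglyMeasurable
    (.of_forall fun _ => norm_halfPlanePoissonKernel_le hu _)

theorem IsPoissonIntegralOf.eq_integral {F : ℂ → ℂ} {ρ : Measure ℝ} {h : ℝ → ℂ}
    (hh : Integrable h ρ) (hF : IsPoissonIntegralOf F (ρ.withDensityᵥ h)) (x : ℝ) {u : ℝ}
    (hu : 0 < u) :
    F (x + u * Complex.I) = ∫ t, halfPlanePoissonKernel u (x - t) • h t ∂ρ := by
  rw [hF x u hu]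
  exact VectorMeasure.integral_withDensityᵥ hh
    ((continuous_halfPlanePoissonKernel hu).measurable.comp (by fun_prop))
    fun _ => norm_halfPlanePoissonKernel_le hu _

theorem IsPoissonIntegralOf.sub {F G : ℂ → ℂ} {μ ν : ComplexMeasure ℝ}
    (hμ : IsPoissonIntegralOf F μ) (hν : IsPoissonIntegralOf G ν) :
    IsPoissonIntegralOf (fun z => F z - G z) (μ - ν) := by
  intro x u hu
  rw [VectorMeasure.integral_sub_vectorMeasure
    (VectorMeasure.integrable_halfPlanePoissonKernel μ x hu)
    (VectorMeasure.integrable_halfPlanePoissonKernel ν x hu), ← hμ x u hu, ← hν x u hu]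

/-- The Poisson kernel has mass `1`, so that Tonelli's theorem turns the integral over the product
into the total variation. -/
theorem lintegral_prod_halfPlanePoissonKernel_mul {ρ : Measure ℝ} [IsFiniteMeasure ρ] {h : ℝ → ℂ}
    (hh : Integrable h ρ) {u : ℝ} (hu : 0 < u) :
    AEMeasurable (fun p : ℝ × ℝ => ‖halfPlanePoissonKernel u (p.1 - p.2)‖ₑ * ‖h p.2‖ₑ)
      ((volume : Measure ℝ).prod ρ) ∧
    ∫⁻ p : ℝ × ℝ, ‖halfPlanePoissonKernel u (p.1 - p.2)‖ₑ * ‖h p.2‖ₑ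
      ∂((volume : Measure ℝ).prod ρ) = ∫⁻ t, ‖h t‖ₑ ∂ρ := by
  have hker : Continuous fun p : ℝ × ℝ => halfPlanePoissonKernel u (p.1 - p.2) :=
    (continuous_halfPlanePoissonKernel hu).comp (by fun_prop)
  have hmeas : AEMeasurable (fun p : ℝ × ℝ => ‖halfPlanePoissonKernel u (p.1 - p.2)‖ₑ * ‖h p.2‖ₑ)
      ((volume : Measure ℝ).prod ρ) :=
    hker.measurable.enorm.aemeasurable.mul (hh.1.comp_snd (μ := (volume : Measure ℝ))).enorm
  refine ⟨hmeas, ?_⟩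
  rw [lintegral_prod_symm _ hmeas]
  congr with t
  dsimp only
  rw [lintegral_mul_const' _ _ enorm_ne_top, lintegral_halfPlanePoissonKernel t hu, one_mul]

theorem IsPoissonIntegralOf.heightL1Norm_le {F : ℂ → ℂ} {μ : ComplexMeasure ℝ}
    (hF : IsPoissonIntegralOf F μ) {u : ℝ} (hu : 0 < u) :
    heightL1Norm F u ≤ μ.variation Set.univ := by
  obtain ⟨ρ, h, _, hh, rfl⟩ := μ.exists_eq_withDensityᵥ
  obtain ⟨hmeas, hprod⟩ := lintegral_prod_halfPlanePoissonKernel_mul hh hu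
  rw [Measure.variation_withDensityᵥ_univ hh, ← hprod, lintegral_prod _ hmeas]
  refine lintegral_mono fun x => ?_
  rw [hF.eq_integral hh x hu]
  refine (enorm_integral_le_lintegral_enorm _).trans_eq ?_
  simp only [enorm_smul]

/-- Fubini's theorem moves the Poisson kernel to the test function. -/
theorem IsPoissonIntegralOf.integral_mul_eq {F : ℂ → ℂ} {ρ : Measure ℝ} [IsFiniteMeasure ρ]
    {h : ℝ → ℂ} (hh : Integrable h ρ) (hF : IsPoissonIntegralOf F (ρ.withDensityᵥ h)) {φ : ℝ → ℂ}
    (hφ : Continuous φ) (hφ1 : ∀ t, ‖φ t‖ ≤ 1) {u : ℝ} (hu : 0 < u) :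
    ∫ x : ℝ, φ x * F (x + u * Complex.I) =
      ∫ t, (∫ x, halfPlanePoissonKernel u (x - t) • φ x) * h t ∂ρ := by
  have hker : Continuous fun p : ℝ × ℝ => halfPlanePoissonKernel u (p.1 - p.2) :=
    (continuous_halfPlanePoissonKernel hu).comp (by fun_prop)
  have hφ' : Continuous fun p : ℝ × ℝ => φ p.1 := hφ.comp continuous_fst
  have hint : Integrable (Function.uncurry fun x t : ℝ =>
      (halfPlanePoissonKernel u (x - t) • φ x) * h t) ((volume : Measure ℝ).prod ρ) := by
    refine ⟨(hker.smul hφ').aestronglyMeasurable.mul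
      (hh.1.comp_snd (μ := (volume : Measure ℝ))), ?_⟩
    obtain ⟨-, hprod⟩ := lintegral_prod_halfPlanePoissonKernel_mul hh hu
    refine lt_of_le_of_lt (lintegral_mono fun p => ?_) (hprod.trans_lt hh.2)
    simp only [Function.uncurry, enorm_mul, enorm_smul]
    gcongr
    refine mul_le_of_le_one_right zero_le ?_
    rw [← ofReal_norm, ENNReal.ofReal_le_one]
    exact hφ1 _
  calc ∫ x : ℝ, φ x * F (x + u * Complex.I)
      = ∫ x : ℝ, (∫ t, (halfPlanePoissonKernel u (x - t) • φ x) * h t ∂ρ) := by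
        congr with x
        rw [hF.eq_integral hh x hu, ← integral_const_mul]
        congr with t
        simp only [Complex.real_smul]; ring
    _ = ∫ t, (∫ x : ℝ, (halfPlanePoissonKernel u (x - t) • φ x) * h t) ∂ρ :=
        integral_integral_swap hint
    _ = _ := by
        congr with t
        rw [integral_mul_const]

/-- Pairing with a bounded continuous function recovers the representing measure from the values of
its Poisson integral at small heights. -/
theorem IsPoissonIntegralOf.tendsto_integral_mul {F : ℂ → ℂ} {ρ : Measure ℝ} [IsFiniteMeasure ρ]
    {h : ℝ → ℂ} (hh : Integrable h ρ) (hF : IsPoissonIntegralOf F (ρ.withDensityᵥ h)) {φ : ℝ → ℂ}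
    (hφ : Continuous φ) (hφ1 : ∀ t, ‖φ t‖ ≤ 1) :
    Tendsto (fun u : ℝ => ∫ x : ℝ, φ x * F (x + u * Complex.I)) (𝓝[>] 0)
      (𝓝 (∫ t, φ t * h t ∂ρ)) := by
  have h1 : Tendsto (fun u : ℝ => ∫ t, (∫ x, halfPlanePoissonKernel u (x - t) • φ x) * h t ∂ρ)
      (𝓝[>] 0) (𝓝 (∫ t, φ t * h t ∂ρ)) := by
    refine tendsto_integral_filter_of_dominated_convergence (fun t => ‖h t‖) ?_ ?_ hh.norm
      (.of_forall fun t => (tendsto_integral_halfPlanePoissonKernel_smul hφ hφ1 t).mul_const _)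
    · filter_upwards [self_mem_nhdsWithin] with u hu
      refine AEStronglyMeasurable.mul ?_ hh.1
      have hcont : Continuous fun p : ℝ × ℝ => halfPlanePoissonKernel u (p.2 - p.1) • φ p.2 :=
        ((continuous_halfPlanePoissonKernel hu).comp (by fun_prop)).smul (hφ.comp (by fun_prop))
      exact (hcont.stronglyMeasurable.integral_prod_right (ν := volume)).aestronglyMeasurable
    · filter_upwards [self_mem_nhdsWithin] with u hu
      refine .of_forall fun t => ?_
      rw [norm_mul]
      exact mul_le_of_le_one_left (norm_nonneg _)
        (norm_integral_halfPlanePoissonKernel_smul_le hu hφ1 t)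
  refine h1.congr' ?_
  filter_upwards [self_mem_nhdsWithin] with u hu
  rw [hF.integral_mul_eq hh hφ hφ1 hu]

/-- The limit is at least the total variation because the latter is approached by pairings with
continuous functions bounded by `1`. -/
theorem IsPoissonIntegralOf.tendsto_heightL1Norm {F : ℂ → ℂ} {μ : ComplexMeasure ℝ}
    (hF : IsPoissonIntegralOf F μ) :
    Tendsto (heightL1Norm F) (𝓝[>] 0) (𝓝 (μ.variation Set.univ)) := by
  refine tendsto_order.2 ⟨fun a ha => ?_, fun a ha => ?_⟩
  · obtain ⟨ρ, h, _, hh, rfl⟩ := μ.exists_eq_withDensityᵥ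
    rw [Measure.variation_withDensityᵥ_univ hh] at ha
    have hatop : a ≠ ∞ := ha.ne_top
    have ha' : a.toReal < ∫ t, ‖h t‖ ∂ρ := by
      rw [integral_norm_eq_lintegral_enorm hh.1]
      exact (ENNReal.toReal_lt_toReal hatop hh.2.ne).2 ha
    obtain ⟨φ, hφ, hφ1, hlt⟩ := hh.exists_continuous_lt_norm_integral_mul ha'
    filter_upwards [(hF.tendsto_integral_mul hh hφ hφ1).norm.eventually_const_lt hlt] with u hu
    have h2 : ENNReal.ofReal a.toReal < ‖∫ x : ℝ, φ x * F (x + u * Complex.I)‖ₑ := by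
      rw [← ofReal_norm]
      exact (ENNReal.ofReal_lt_ofReal_iff_of_nonneg ENNReal.toReal_nonneg).2 hu
    rw [ENNReal.ofReal_toReal hatop] at h2
    refine h2.trans_le ((enorm_integral_le_lintegral_enorm _).trans (lintegral_mono fun x => ?_))
    rw [enorm_mul]
    refine mul_le_of_le_one_left zero_le ?_
    rw [← ofReal_norm, ENNReal.ofReal_le_one]
    exact hφ1 x
  · filter_upwards [self_mem_nhdsWithin] with u hu
    exact (hF.heightL1Norm_le hu).trans_lt ha

/-- The difference of two representing measures represents `0`, hence has total variation `0`. -/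
theorem IsPoissonIntegralOf.unique {F : ℂ → ℂ} {μ ν : ComplexMeasure ℝ}
    (hμ : IsPoissonIntegralOf F μ) (hν : IsPoissonIntegralOf F ν) : μ = ν := by
  have h1 := (hμ.sub hν).tendsto_heightL1Norm
  have h2 : heightL1Norm (fun z => F z - F z) = fun _ => 0 := by
    ext u; simp [heightL1Norm]
  rw [h2] at h1
  have h3 := tendsto_nhds_unique h1 tendsto_const_nhds
  rw [Measure.measure_univ_eq_zero, VectorMeasure.variation_eq_zero] at h3
  exact sub_eq_zero.1 h3

/-! ### Weak limits of densities bounded in `L¹` -/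

/-- Densities bounded in `L¹(ℝ)` need not be tight, but they become so after multiplication by
`(1 + t²)⁻¹`. Prokhorov's theorem then gives a limit when testing against functions which decay
like `(1 + t²)⁻¹`. -/
theorem exists_tendsto_integral_mul_of_lintegral_le {ι : Type*} (l : Ultrafilter ι)
    {f : ι → ℝ → ℝ} (hf : ∀ i, Measurable (f i)) (hf0 : ∀ i t, 0 ≤ f i t) {K : ℝ≥0}
    (hK : ∀ i, ∫⁻ t, ENNReal.ofReal (f i t) ≤ K) :
    ∃ μ : Measure ℝ, IsFiniteMeasure μ ∧ ∀ g : ℝ → ℝ, Continuous g →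
      ∀ C : ℝ, (∀ t, |g t| * (1 + t ^ 2) ≤ C) →
        Tendsto (fun i => ∫ t, g t * f i t) l (𝓝 (∫ t, g t ∂μ)) := by
  have hpos (t : ℝ) : 0 < 1 + t ^ 2 := by positivity
  set d : ι → ℝ → ℝ≥0∞ := fun i t => ENNReal.ofReal (f i t * (1 + t ^ 2)⁻¹) with hd
  have hdm (i : ι) : Measurable (d i) := by
    have := hf i
    simp only [hd]; fun_prop
  have hdle (i : ι) (s : Set ℝ) (hs : MeasurableSet s) (b : ℝ≥0)
      (hb : ∀ t ∈ s, (1 + t ^ 2)⁻¹ ≤ (b : ℝ)) : volume.withDensity (d i) s ≤ b * K := by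
    rw [withDensity_apply _ hs]
    calc ∫⁻ t in s, d i t ≤ ∫⁻ t in s, b * ENNReal.ofReal (f i t) := by
          refine setLIntegral_mono' hs fun t ht => ?_
          simp only [hd]
          rw [← ENNReal.ofReal_coe_nnreal, ← ENNReal.ofReal_mul b.coe_nonneg, mul_comm]
          exact ENNReal.ofReal_le_ofReal (mul_le_mul_of_nonneg_right (hb t ht) (hf0 i t))
      _ ≤ ∫⁻ t, b * ENNReal.ofReal (f i t) := setLIntegral_le_lintegral _ _
      _ = b * ∫⁻ t, ENNReal.ofReal (f i t) := lintegral_const_mul' _ _ ENNReal.coe_ne_top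
      _ ≤ b * K := by gcongr; exact hK i
  have hmass (i : ι) : volume.withDensity (d i) Set.univ ≤ K := by
    simpa using hdle i Set.univ MeasurableSet.univ 1 fun t _ => by
      simpa using inv_le_one_of_one_le₀ (by nlinarith [sq_nonneg t])
  set ν : ι → FiniteMeasure ℝ := fun i =>
    ⟨volume.withDensity (d i), ⟨(hmass i).trans_lt ENNReal.coe_lt_top⟩⟩ with hν
  set c : ℕ → ℝ≥0 := fun n => (1 + (n : ℝ≥0) ^ 2)⁻¹ * K with hc
  have hc0 : Tendsto c atTop (𝓝 0) := by
    rw [show (0 : ℝ≥0) = 0 * K by simp]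
    refine Tendsto.mul_const _ (tendsto_inv_atTop_zero.comp ?_)
    refine tendsto_atTop_mono (fun n => ?_) (tendsto_natCast_atTop_atTop (R := ℝ≥0))
    exact_mod_cast (by nlinarith : n ≤ 1 + n ^ 2)
  have hcomp := isCompact_setOfPred_finiteMeasure_mass_le_compl_isCompact_le
    (u := c) (K := fun n : ℕ => Set.Icc (-(n : ℝ)) n) K hc0 (fun n => isCompact_Icc)
    (Or.inl inferInstance)
  have hmem (i : ι) : ν i ∈ {μ : FiniteMeasure ℝ | μ.mass ≤ K ∧
      ∀ n : ℕ, μ (Set.Icc (-(n : ℝ)) n)ᶜ ≤ c n} := by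
    refine ⟨?_, fun n => ?_⟩
    · rw [← ENNReal.coe_le_coe, FiniteMeasure.ennreal_mass]
      exact hmass i
    · rw [← ENNReal.coe_le_coe, FiniteMeasure.ennreal_coeFn_eq_coeFn_toMeasure]
      simp only [hc, ENNReal.coe_mul]
      refine hdle i _ measurableSet_Icc.compl _ fun t ht => ?_
      push_cast
      refine inv_anti₀ (by positivity) ?_
      have : (n : ℝ) ≤ |t| := by
        by_contra! h
        exact ht ⟨(abs_lt.1 h).1.le, (abs_lt.1 h).2.le⟩
      nlinarith [sq_abs t, abs_nonneg t, (Nat.cast_nonneg n : (0 : ℝ) ≤ n)]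
  obtain ⟨ν₀, -, hlim⟩ := isCompact_iff_ultrafilter_le_nhds.1 hcomp (l.map ν)
    (le_principal_iff.2 (Filter.mem_map.2 (univ_mem' hmem)))
  have hlim' : Tendsto ν l (𝓝 ν₀) := hlim
  rw [FiniteMeasure.tendsto_iff_forall_integral_tendsto] at hlim'
  have hG (G : ℝ → ℝ) (hGc : Continuous G) (C : ℝ) (hGC : ∀ t, |G t| ≤ C) :
      Tendsto (fun i => ∫ t, G t * (f i t * (1 + t ^ 2)⁻¹)) l (𝓝 (∫ t, G t ∂(ν₀ : Measure ℝ))) := by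
    have h := hlim' (BoundedContinuousFunction.ofNormedAddCommGroup G hGc C hGC)
    refine h.congr fun i => ?_
    change ∫ t, G t ∂(volume.withDensity (d i)) = _
    rw [integral_withDensity_eq_integral_toReal_smul (hdm i)
      (.of_forall fun t => ENNReal.ofReal_lt_top)]
    congr with t
    simp only [hd, smul_eq_mul]
    rw [ENNReal.toReal_ofReal (mul_nonneg (hf0 i t) (inv_nonneg.2 (hpos t).le)), mul_comm]
  set wt : ℝ → ℝ≥0∞ := fun t => ENNReal.ofReal (1 + t ^ 2) with hwt
  have hwtm : Measurable wt := by simp only [hwt]; fun_prop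
  have hfint (i : ι) : Integrable (f i) := by
    refine ⟨(hf i).aestronglyMeasurable, ?_⟩
    refine lt_of_le_of_lt (le_of_eq ?_) ((hK i).trans_lt ENNReal.coe_lt_top)
    congr with t
    rw [Real.enorm_of_nonneg (hf0 i t)]
  have hfle (i : ι) : ∫ t, f i t ≤ K := by
    rw [integral_eq_lintegral_of_nonneg_ae (.of_forall (hf0 i)) (hf i).aestronglyMeasurable]
    exact ENNReal.toReal_le_coe_of_le_coe (hK i)
  -- the weight `1 + t²` is unbounded: truncate it and pass to the limit monotonically
  have htrunc (n : ℕ) : ∫⁻ t, ENNReal.ofReal (min (1 + t ^ 2) n) ∂(ν₀ : Measure ℝ) ≤ K := by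
    have hnn (t : ℝ) : 0 ≤ min (1 + t ^ 2) (n : ℝ) := le_min (hpos t).le (Nat.cast_nonneg n)
    have hcont : Continuous fun t : ℝ => min (1 + t ^ 2) (n : ℝ) := by fun_prop
    have hbd (t : ℝ) : |min (1 + t ^ 2) (n : ℝ)| ≤ n := by
      rw [abs_of_nonneg (hnn t)]; exact min_le_right _ _
    have h1 := hG _ hcont n hbd
    have h2 : ∫ t, min (1 + t ^ 2) (n : ℝ) ∂(ν₀ : Measure ℝ) ≤ K := by
      refine le_of_tendsto h1 (.of_forall fun i => le_trans ?_ (hfle i))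
      refine integral_mono_of_nonneg (.of_forall fun t => ?_) (hfint i) (.of_forall fun t => ?_)
      · exact mul_nonneg (hnn t) (mul_nonneg (hf0 i t) (inv_nonneg.2 (hpos t).le))
      · have : min (1 + t ^ 2) (n : ℝ) * (1 + t ^ 2)⁻¹ ≤ 1 := by
          rw [← div_eq_mul_inv, div_le_one (hpos t)]; exact min_le_left _ _
        calc min (1 + t ^ 2) (n : ℝ) * (f i t * (1 + t ^ 2)⁻¹)
            = (min (1 + t ^ 2) (n : ℝ) * (1 + t ^ 2)⁻¹) * f i t := by ring
          _ ≤ f i t := mul_le_of_le_one_left (hf0 i t) this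
    have hi : Integrable (fun t : ℝ => min (1 + t ^ 2) (n : ℝ)) (ν₀ : Measure ℝ) :=
      .of_bound hcont.aestronglyMeasurable n (.of_forall hbd)
    rw [← ofReal_integral_eq_lintegral_ofReal hi (.of_forall hnn)]
    exact ENNReal.ofReal_le_of_le_toReal (by simpa using h2)
  have hwtK : ∫⁻ t, wt t ∂(ν₀ : Measure ℝ) ≤ K := by
    refine le_of_tendsto (lintegral_tendsto_of_tendsto_of_monotone (μ := (ν₀ : Measure ℝ))
      (f := fun (n : ℕ) t => ENNReal.ofReal (min (1 + t ^ 2) (n : ℝ))) (F := wt)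
      (fun n => by fun_prop) (.of_forall fun t m n hmn => ?_) (.of_forall fun t => ?_))
      (.of_forall htrunc)
    · exact ENNReal.ofReal_le_ofReal (min_le_min_left _ (by exact_mod_cast hmn))
    · refine tendsto_const_nhds.congr' ?_
      obtain ⟨N, hN⟩ := exists_nat_ge (1 + t ^ 2)
      filter_upwards [eventually_ge_atTop N] with n hn
      rw [min_eq_left (hN.trans (by exact_mod_cast hn))]
  refine ⟨(ν₀ : Measure ℝ).withDensity wt, ?_, fun g hg C hC => ?_⟩
  · exact isFiniteMeasure_withDensity (hwtK.trans_lt ENNReal.coe_lt_top).ne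
  · have h1 := hG (fun t => g t * (1 + t ^ 2)) (by fun_prop) C fun t => by
      rw [abs_mul, abs_of_pos (hpos t)]; exact hC t
    rw [integral_withDensity_eq_integral_toReal_smul hwtm
      (.of_forall fun t => ENNReal.ofReal_lt_top)]
    convert h1 using 2
    · congr with t
      field_simp
    · congr with t
      simp only [hwt, smul_eq_mul]
      rw [ENNReal.toReal_ofReal (hpos t).le, mul_comm]

/-- Functions bounded in `L¹(ℝ)` have a complex measure as a weak limit, for test functions which
decay like `(1 + t²)⁻¹`. -/
theorem exists_complexMeasure_tendsto_integral_smul {ι : Type*} (l : Ultrafilter ι)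
    {f : ι → ℝ → ℂ} (hf : ∀ i, Measurable (f i)) {K : ℝ≥0} (hK : ∀ i, ∫⁻ t, ‖f i t‖ₑ ≤ K) :
    ∃ μ : ComplexMeasure ℝ, ∀ g : ℝ → ℝ, Continuous g →
      ∀ C : ℝ, (∀ t, |g t| * (1 + t ^ 2) ≤ C) →
        Tendsto (fun i => ∫ t, g t • f i t) l (𝓝 (∫ᵛ t, g t ∂•μ)) := by
  have hgle {g : ℝ → ℝ} {C : ℝ} (hC : ∀ t, |g t| * (1 + t ^ 2) ≤ C) (t : ℝ) : ‖g t‖ ≤ C := by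
    refine le_trans ?_ (hC t)
    rw [Real.norm_eq_abs]
    nlinarith [abs_nonneg (g t), sq_nonneg t, mul_nonneg (abs_nonneg (g t)) (sq_nonneg t)]
  -- split `f` into the positive and negative parts of its real and imaginary parts
  have key (z : ℂ) (q : ℂ → ℝ) (hq : Measurable q) (hq0 : ∀ w, 0 ≤ q w)
      (hqn : ∀ w, q w ≤ ‖w‖) :
      ∃ μ : ComplexMeasure ℝ, ∀ g : ℝ → ℝ, Continuous g →
        ∀ C : ℝ, (∀ t, |g t| * (1 + t ^ 2) ≤ C) →
          Tendsto (fun i => (∫ t, g t * q (f i t)) • z) l (𝓝 (∫ᵛ t, g t ∂•μ)) := by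
    obtain ⟨ρ, _, hρ⟩ := exists_tendsto_integral_mul_of_lintegral_le l
      (f := fun i t => q (f i t)) (fun i => hq.comp (hf i)) (fun i t => hq0 _) (K := K)
      fun i => (lintegral_mono fun t => by
        rw [← ofReal_norm]; exact ENNReal.ofReal_le_ofReal (hqn _)).trans (hK i)
    refine ⟨ρ.withDensityᵥ fun _ => z, fun g hg C hC => ?_⟩
    rw [VectorMeasure.integral_withDensityᵥ (integrable_const z) hg.measurable (hgle hC),
      integral_smul_const]
    exact (hρ g hg C hC).smul_const z
  have hre := Complex.measurable_re
  have him := Complex.measurable_im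
  obtain ⟨μ₁, h₁⟩ := key 1 (fun w => max w.re 0) (hre.max measurable_const)
    (fun w => le_max_right _ _) fun w => max_le (Complex.re_le_norm w) (norm_nonneg w)
  obtain ⟨μ₂, h₂⟩ := key (-1) (fun w => max (-w.re) 0) (hre.neg.max measurable_const)
    (fun w => le_max_right _ _)
    fun w => max_le (by simpa using Complex.re_le_norm (-w)) (norm_nonneg w)
  obtain ⟨μ₃, h₃⟩ := key Complex.I (fun w => max w.im 0) (him.max measurable_const)
    (fun w => le_max_right _ _) fun w => max_le (Complex.im_le_norm w) (norm_nonneg w)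
  obtain ⟨μ₄, h₄⟩ := key (-Complex.I) (fun w => max (-w.im) 0) (him.neg.max measurable_const)
    (fun w => le_max_right _ _)
    fun w => max_le (by simpa using Complex.im_le_norm (-w)) (norm_nonneg w)
  refine ⟨μ₁ + μ₂ + (μ₃ + μ₄), fun g hg C hC => ?_⟩
  have hi (μ : ComplexMeasure ℝ) : VectorMeasure.Integrable μ g :=
    .of_bound hg.aestronglyMeasurable C (.of_forall (hgle hC))
  rw [VectorMeasure.integral_add_vectorMeasure (hi _) (hi _),
    VectorMeasure.integral_add_vectorMeasure (hi _) (hi _),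
    VectorMeasure.integral_add_vectorMeasure (hi _) (hi _)]
  refine (((h₁ g hg C hC).add (h₂ g hg C hC)).add
    ((h₃ g hg C hC).add (h₄ g hg C hC))).congr fun i => ?_
  have hfi : Integrable (f i) :=
    ⟨(hf i).aestronglyMeasurable, (hK i).trans_lt ENNReal.coe_lt_top⟩
  have hint (z : ℂ) (q : ℂ → ℝ) (hq : Measurable q) (hq0 : ∀ w, 0 ≤ q w)
      (hqn : ∀ w, q w ≤ ‖w‖) : Integrable fun t => (g t * q (f i t)) • z := by
    refine Integrable.smul_const (Integrable.bdd_mul (c := C) (hfi.mono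
      (hq.comp (hf i)).aestronglyMeasurable (.of_forall fun t => ?_))
      hg.aestronglyMeasurable (.of_forall (hgle hC))) z
    rw [Function.comp_apply, Real.norm_of_nonneg (hq0 _)]
    exact hqn _
  have i₁ := hint 1 (fun w => max w.re 0) (hre.max measurable_const)
    (fun w => le_max_right _ _) fun w => max_le (Complex.re_le_norm w) (norm_nonneg w)
  have i₂ := hint (-1) (fun w => max (-w.re) 0) (hre.neg.max measurable_const)
    (fun w => le_max_right _ _)
    fun w => max_le (by simpa using Complex.re_le_norm (-w)) (norm_nonneg w)
  have i₃ := hint Complex.I (fun w => max w.im 0) (him.max measurable_const)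
    (fun w => le_max_right _ _) fun w => max_le (Complex.im_le_norm w) (norm_nonneg w)
  have i₄ := hint (-Complex.I) (fun w => max (-w.im) 0) (him.neg.max measurable_const)
    (fun w => le_max_right _ _)
    fun w => max_le (by simpa using Complex.im_le_norm (-w)) (norm_nonneg w)
  simp only [← integral_smul_const]
  rw [← integral_add i₁ i₂, ← integral_add i₃ i₄]
  refine (integral_add (i₁.add i₂) (i₃.add i₄)).symm.trans ?_
  congr with t
  simp only [Pi.add_apply]
  have h1 := max_zero_sub_max_neg_zero_eq_self (f i t).re
  have h2 := max_zero_sub_max_neg_zero_eq_self (f i t).im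
  apply Complex.ext
  · simp [-neg_smul]
    linear_combination g t * h1
  · simp
    linear_combination g t * h2

/-! ### Harmonic functions with bounded `L¹` norms are bounded away from the boundary -/

theorem Real.circleAverage_eq_integral_neg_pi_pi {E : Type*} [NormedAddCommGroup E]
    [NormedSpace ℝ E] (f : ℂ → E) (c : ℂ) (R η : ℝ) :
    Real.circleAverage f c R =
      (2 * Real.pi)⁻¹ • ∫ θ in (-Real.pi)..Real.pi, f (circleMap c R (θ + η)) := by
  rw [Real.circleAverage_eq_integral_add (η - Real.pi)]
  have h := intervalIntegral.integral_comp_sub_right (a := 0) (b := 2 * Real.pi)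
    (fun θ => f (circleMap c R (θ + η))) Real.pi
  rw [show (0 : ℝ) - Real.pi = -Real.pi by ring,
    show 2 * Real.pi - Real.pi = Real.pi by ring] at h
  rw [← h]
  congr with θ
  ring_nf

/-- The area mean value inequality. -/
theorem InnerProductSpace.HarmonicOnNhd.enorm_mul_le_lintegral_ball {F : ℂ → ℂ} {z : ℂ} {R : ℝ}
    (hR : 0 < R) (hF : InnerProductSpace.HarmonicOnNhd F (Metric.ball z R)) :
    Measurable ((Metric.ball z R).indicator fun w => ‖F w‖ₑ) ∧
    ENNReal.ofReal (Real.pi * R ^ 2) * ‖F z‖ₑ ≤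
      ∫⁻ w, (Metric.ball z R).indicator (fun w => ‖F w‖ₑ) w := by
  set G : ℂ → ℝ≥0∞ := (Metric.ball z R).indicator fun w => ‖F w‖ₑ with hG
  have hGm : Measurable G := by
    classical
    rw [hG, ← Set.piecewise_eq_indicator]
    exact ContinuousOn.measurable_piecewise hF.continuousOn.enorm continuousOn_const
      measurableSet_ball
  refine ⟨hGm, ?_⟩
  have hcircle (r : ℝ) (hr : r ∈ Set.Ioo 0 R) :
      ENNReal.ofReal (2 * Real.pi) * ‖F z‖ₑ ≤
        ∫⁻ θ in Set.Ioo (-Real.pi) Real.pi, G (z + Complex.polarCoord.symm (r, θ)) := by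
    have h1 : Real.circleAverage F z r = F z := by
      apply InnerProductSpace.HarmonicOnNhd.circleAverage_eq
      rw [abs_of_pos hr.1]
      exact hF.mono (Metric.closedBall_subset_ball hr.2)
    rw [Real.circleAverage_eq_integral_neg_pi_pi F z r 0] at h1
    have h2 : (2 * Real.pi) • F z = ∫ θ in (-Real.pi)..Real.pi, F (circleMap z r (θ + 0)) := by
      rw [← h1, smul_smul, mul_inv_cancel₀ (by positivity), one_smul]
    have h3 : ENNReal.ofReal (2 * Real.pi) * ‖F z‖ₑ = ‖(2 * Real.pi) • F z‖ₑ := by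
      rw [enorm_smul, Real.enorm_of_nonneg (by positivity)]
    rw [h3, h2, intervalIntegral.integral_of_le (by linarith [Real.pi_pos]),
      integral_Ioc_eq_integral_Ioo]
    refine (enorm_integral_le_lintegral_enorm _).trans_eq ?_
    refine lintegral_congr fun θ => ?_
    have h4 : circleMap z r (θ + 0) = z + Complex.polarCoord.symm (r, θ) := by
      rw [Complex.polarCoord_symm_apply, circleMap, add_zero, Complex.exp_mul_I]
      simp
    have h5 : circleMap z r (θ + 0) ∈ Metric.ball z R :=
      Metric.closedBall_subset_ball hr.2 (circleMap_mem_closedBall z hr.1.le _)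
    rw [← h4, hG, Set.indicator_of_mem h5]
  have hpolar := Complex.lintegral_comp_polarCoord_symm fun w => G (z + w)
  rw [lintegral_add_left_eq_self G z] at hpolar
  rw [← hpolar, polarCoord_target, Measure.volume_eq_prod, ← Measure.prod_restrict,
    lintegral_prod _ (by
      refine Measurable.aemeasurable ?_
      refine (ENNReal.measurable_ofReal.comp measurable_fst).mul (hGm.comp ?_)
      refine measurable_const.add ?_
      have : (Complex.polarCoord.symm : ℝ × ℝ → ℂ) = fun p : ℝ × ℝ =>
          (p.1 : ℂ) * (Real.cos p.2 + Real.sin p.2 * Complex.I) := by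
        ext p; exact Complex.polarCoord_symm_apply p
      rw [this]
      fun_prop)]
  have hint : ∫⁻ r in Set.Ioo 0 R, ENNReal.ofReal r = ENNReal.ofReal (R ^ 2 / 2) := by
    rw [← ofReal_integral_eq_lintegral_ofReal]
    · rw [← integral_Ioc_eq_integral_Ioo, ← intervalIntegral.integral_of_le hR.le, integral_id]
      simp
    · exact (continuous_id.integrableOn_Icc (a := 0) (b := R)).mono_set Set.Ioo_subset_Icc_self
    · filter_upwards [ae_restrict_mem measurableSet_Ioo] with r hr using hr.1.le
  calc ENNReal.ofReal (Real.pi * R ^ 2) * ‖F z‖ₑ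
      = ENNReal.ofReal (R ^ 2 / 2) * (ENNReal.ofReal (2 * Real.pi) * ‖F z‖ₑ) := by
        rw [← mul_assoc, ← ENNReal.ofReal_mul (by positivity)]
        congr 2; ring
    _ = ∫⁻ r in Set.Ioo 0 R, ENNReal.ofReal r * (ENNReal.ofReal (2 * Real.pi) * ‖F z‖ₑ) := by
        rw [lintegral_mul_const' _ _ (by finiteness), hint]
    _ ≤ ∫⁻ r in Set.Ioo 0 R, ∫⁻ θ in Set.Ioo (-Real.pi) Real.pi,
          ENNReal.ofReal r • G (z + Complex.polarCoord.symm (r, θ)) := by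
        refine setLIntegral_mono' measurableSet_Ioo fun r hr => ?_
        simp only [smul_eq_mul]
        rw [lintegral_const_mul' _ _ ENNReal.ofReal_ne_top]
        gcongr
        exact hcircle r hr
    _ ≤ _ := lintegral_mono_set Set.Ioo_subset_Ioi_self

/-- By the mean value property over a disc of radius `u / 2`, a bound on the `L¹` norms of a
harmonic function bounds the function at height `u` by a multiple of `1 / u`. -/
theorem InnerProductSpace.HarmonicOnNhd.norm_le_of_heightL1Norm_le {F : ℂ → ℂ}
    (hF : InnerProductSpace.HarmonicOnNhd F {z : ℂ | 0 < z.im}) {K : ℝ≥0}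
    (hK : ∀ u : ℝ, 0 < u → heightL1Norm F u ≤ K) {z : ℂ} (hz : 0 < z.im) :
    ‖F z‖ ≤ 4 * K / (Real.pi * z.im) := by
  set u := z.im with hu
  have him {w : ℂ} (hw : w ∈ Metric.ball z (u / 2)) : w.im ∈ Set.Ioo (u / 2) (3 * u / 2) := by
    have h1 : |w.im - z.im| < u / 2 := by
      rw [← Complex.sub_im]
      exact (Complex.abs_im_le_norm _).trans_lt (by simpa [dist_eq_norm] using hw)
    rw [abs_lt] at h1
    constructor <;> linarith [h1.1, h1.2]
  obtain ⟨hGm, hle⟩ := InnerProductSpace.HarmonicOnNhd.enorm_mul_le_lintegral_ball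
    (F := F) (z := z) (half_pos hz) (hF.mono fun w hw => by
      have := (him hw).1
      simp only [Set.mem_ofPred_eq]; linarith)
  set G : ℂ → ℝ≥0∞ := (Metric.ball z (u / 2)).indicator fun w => ‖F w‖ₑ with hG
  have hprod : ∫⁻ w, G w ≤ ENNReal.ofReal u * K := by
    have hmp := Complex.volume_preserving_equiv_real_prod.symm
    rw [← hmp.lintegral_comp hGm, Measure.volume_eq_prod,
      lintegral_prod_symm (fun p => G (Complex.measurableEquivRealProd.symm p))
        (hGm.comp hmp.measurable).aemeasurable]
    calc ∫⁻ y : ℝ, ∫⁻ x : ℝ, G (Complex.measurableEquivRealProd.symm (x, y))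
        ≤ ∫⁻ y : ℝ, (Set.Ioo (u / 2) (3 * u / 2)).indicator (fun _ => (K : ℝ≥0∞)) y := by
          refine lintegral_mono fun y => ?_
          have hxy (x : ℝ) : Complex.measurableEquivRealProd.symm (x, y) = x + y * Complex.I := by
            apply Complex.ext <;> simp [Complex.measurableEquivRealProd_symm_apply]
          simp only [hxy]
          by_cases hy : y ∈ Set.Ioo (u / 2) (3 * u / 2)
          · rw [Set.indicator_of_mem hy]
            refine le_trans (lintegral_mono fun x => ?_) (hK y (by linarith [hy.1]))
            exact Set.indicator_le_self _ _ _
          · rw [Set.indicator_of_notMem hy]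
            refine (lintegral_eq_zero_of_ae_eq_zero (.of_forall fun x => ?_)).le
            refine Set.indicator_of_notMem (fun hw => hy ?_) _
            simpa using him hw
      _ = ENNReal.ofReal u * K := by
          rw [lintegral_indicator_const measurableSet_Ioo, Real.volume_Ioo, mul_comm]
          congr 2; ring
  have h1 := hle.trans hprod
  have h2 : Real.pi * (u / 2) ^ 2 * ‖F z‖ ≤ u * K := by
    have := ENNReal.toReal_mono (by finiteness) h1
    rwa [ENNReal.toReal_mul, ENNReal.toReal_mul, ENNReal.toReal_ofReal (by positivity),
      ENNReal.toReal_ofReal hz.le, toReal_enorm, ENNReal.coe_toReal] at this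
  rw [le_div_iff₀ (by positivity)]
  have h3 : u * (‖F z‖ * (Real.pi * u)) ≤ u * (4 * K) := by nlinarith
  exact le_of_mul_le_mul_left h3 hz

/-! ### The Poisson formula on half planes by exhaustion with discs -/

theorem HasDerivAt.tendsto_mul_comp_div_atTop {g : ℝ → ℝ} {g' : ℝ} (hg : HasDerivAt g g' 0)
    (h0 : g 0 = 0) (t : ℝ) : Tendsto (fun R : ℝ => R * g (t / R)) atTop (𝓝 (t * g')) := by
  have h1 : HasDerivAt (fun s : ℝ => g (t * s)) (t * g') 0 := by
    have h2 : HasDerivAt (fun s : ℝ => t * s) t 0 := by simpa using (hasDerivAt_id 0).const_mul t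
    have h3 : HasDerivAt g g' (t * 0) := by simpa using hg
    simpa [mul_comm, Function.comp_def] using h3.comp (0 : ℝ) h2
  rw [hasDerivAt_iff_tendsto_slope_zero] at h1
  have h2 : Tendsto (fun R : ℝ => R⁻¹) atTop (𝓝[≠] 0) :=
    tendsto_inv_atTop_nhdsGT_zero.mono_right (nhdsWithin_mono _ fun x hx => ne_of_gt hx)
  refine (h1.comp h2).congr fun R => ?_
  simp [h0, div_eq_mul_inv]

/-- Arc length parametrization of the circle of radius `R` which touches the horizontal line at
height `δ` from above in `δ i`. -/
noncomputable def horocircle (δ R t : ℝ) : ℂ :=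
  ((R * Real.sin (t / R) : ℝ) : ℂ) + ((δ + R * (1 - Real.cos (t / R)) : ℝ) : ℂ) * Complex.I

@[simp] theorem horocircle_im (δ R t : ℝ) :
    (horocircle δ R t).im = δ + R * (1 - Real.cos (t / R)) := by
  simp [horocircle, -Complex.ofReal_mul, -Complex.ofReal_add]

theorem le_horocircle_im (δ : ℝ) {R : ℝ} (hR : 0 ≤ R) (t : ℝ) : δ ≤ (horocircle δ R t).im := by
  rw [horocircle_im]
  nlinarith [Real.cos_le_one (t / R)]

theorem continuous_horocircle (δ R : ℝ) : Continuous (horocircle δ R) := by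
  unfold horocircle; fun_prop

theorem circleMap_eq_horocircle (δ R t : ℝ) :
    circleMap ((R + δ : ℝ) * Complex.I) R (t / R + -(Real.pi / 2)) = horocircle δ R t := by
  have h1 : Real.cos (t / R + -(Real.pi / 2)) = Real.sin (t / R) := by
    rw [← sub_eq_add_neg, Real.cos_sub_pi_div_two]
  have h2 : Real.sin (t / R + -(Real.pi / 2)) = -Real.cos (t / R) := by
    rw [← sub_eq_add_neg, Real.sin_sub_pi_div_two]
  rw [circleMap, Complex.exp_mul_I, ← Complex.ofReal_cos, ← Complex.ofReal_sin, h1, h2, horocircle]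
  push_cast
  ring

theorem tendsto_horocircle (δ t : ℝ) :
    Tendsto (fun R => horocircle δ R t) atTop (𝓝 (t + δ * Complex.I)) := by
  have h1 : Tendsto (fun R : ℝ => R * Real.sin (t / R)) atTop (𝓝 t) := by
    simpa using (Real.hasDerivAt_sin 0).tendsto_mul_comp_div_atTop (by simp) t
  have h2 : Tendsto (fun R : ℝ => R * (1 - Real.cos (t / R))) atTop (𝓝 0) := by
    have : HasDerivAt (fun s => 1 - Real.cos s) 0 0 := by
      simpa using (Real.hasDerivAt_cos 0).const_sub 1
    simpa using this.tendsto_mul_comp_div_atTop (by simp) t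
  have h3 := ((Complex.continuous_ofReal.tendsto t).comp h1).add
    (((Complex.continuous_ofReal.tendsto (δ + 0)).comp (h2.const_add δ)).mul_const Complex.I)
  simpa [horocircle, Function.comp_def] using h3

/-- The circles stay away from the interior point `x + (u + δ) i` at the rate needed for a dominated
convergence argument, uniformly in the radius. -/
theorem one_add_sq_le_mul_norm_horocircle_sub_sq {δ x u R t : ℝ} (hu : 0 < u)
    (hR : (x ^ 2 + u ^ 2) / u ≤ R) (ht : |t| ≤ Real.pi * R) :
    1 + t ^ 2 ≤ (4 / u ^ 2 + (Real.pi / 2 * (1 + 2 * ‖(x + u * Complex.I : ℂ)‖ / u)) ^ 2) *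
      ‖horocircle δ R t - (x + (u + δ : ℝ) * Complex.I)‖ ^ 2 := by
  set D := ‖horocircle δ R t - (x + (u + δ : ℝ) * Complex.I)‖ with hD
  set N := ‖(x + u * Complex.I : ℂ)‖ with hN
  have hD0 : 0 ≤ D := norm_nonneg _
  have hN0 : 0 ≤ N := norm_nonneg _
  have hR' : x ^ 2 + u ^ 2 ≤ R * u := by rwa [div_le_iff₀ hu] at hR
  have hR0 : 0 < R := by nlinarith [sq_nonneg x, sq_pos_of_pos hu]
  -- near `t = 0`: the distance from the interior point to the whole circle
  have h1 : u / 2 ≤ D := by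
    have hc : ‖horocircle δ R t - (R + δ : ℝ) * Complex.I‖ = R := by
      rw [← circleMap_eq_horocircle, circleMap_sub_center, norm_circleMap_zero, abs_of_pos hR0]
    have hw : ‖(x + (u + δ : ℝ) * Complex.I : ℂ) - (R + δ : ℝ) * Complex.I‖ ≤ R - u / 2 := by
      have : (x + (u + δ : ℝ) * Complex.I : ℂ) - (R + δ : ℝ) * Complex.I =
          x + (u - R : ℝ) * Complex.I := by push_cast; ring
      rw [this, Complex.norm_add_mul_I]
      have hRu : u ≤ R := by nlinarith [sq_nonneg x]
      rw [Real.sqrt_le_left (by linarith)]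
      nlinarith
    have := norm_sub_norm_le (horocircle δ R t - (R + δ : ℝ) * Complex.I)
      ((x + (u + δ : ℝ) * Complex.I : ℂ) - (R + δ : ℝ) * Complex.I)
    rw [sub_sub_sub_cancel_right, ← hD, hc] at this
    linarith
  -- for large `t`: the chord is comparable to the arc
  have h2 : 2 / Real.pi * |t| ≤ ‖horocircle δ R t - δ * Complex.I‖ := by
    have hh : horocircle δ R t - δ * Complex.I = ((R * Real.sin (t / R) : ℝ) : ℂ) +
        ((R * (1 - Real.cos (t / R)) : ℝ) : ℂ) * Complex.I := by
      rw [horocircle]; push_cast; ring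
    rw [hh, Complex.norm_add_mul_I]
    apply Real.le_sqrt_of_sq_le
    have hcos : Real.cos (t / R) ≤ 1 - 2 / Real.pi ^ 2 * (t / R) ^ 2 := by
      apply Real.cos_le_one_sub_mul_cos_sq
      rw [abs_div, abs_of_pos hR0, div_le_iff₀ hR0]
      exact ht
    have hsc := Real.sin_sq_add_cos_sq (t / R)
    have e1 : (R * Real.sin (t / R)) ^ 2 + (R * (1 - Real.cos (t / R))) ^ 2 =
        2 * R ^ 2 * (1 - Real.cos (t / R)) := by
      linear_combination R ^ 2 * hsc
    have e2 : (2 / Real.pi * |t|) ^ 2 = 2 * R ^ 2 * (2 / Real.pi ^ 2 * (t / R) ^ 2) := by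
      rw [mul_pow, sq_abs]; field_simp
    rw [e1, e2]
    gcongr
    linarith
  have h3 : ‖horocircle δ R t - δ * Complex.I‖ ≤ D + N := by
    have : horocircle δ R t - δ * Complex.I =
        (horocircle δ R t - (x + (u + δ : ℝ) * Complex.I)) + (x + u * Complex.I) := by
      push_cast; ring
    rw [this]
    exact norm_add_le _ _
  have h4 : |t| ≤ Real.pi / 2 * (1 + 2 * N / u) * D := by
    have h5 : N ≤ 2 * N / u * D := by
      rw [div_mul_eq_mul_div, le_div_iff₀ hu]; nlinarith
    calc |t| = Real.pi / 2 * (2 / Real.pi * |t|) := by field_simp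
      _ ≤ Real.pi / 2 * (D + 2 * N / u * D) := by gcongr; linarith
      _ = _ := by ring
  have h6 : t ^ 2 ≤ (Real.pi / 2 * (1 + 2 * N / u) * D) ^ 2 := by
    rw [← sq_abs]; gcongr
  have h7 : 1 ≤ 4 / u ^ 2 * D ^ 2 := by
    rw [div_mul_eq_mul_div, le_div_iff₀ (by positivity)]; nlinarith
  nlinarith

/-- The Poisson formula for the disc of radius `R` which touches the horizontal line at height `δ`,
written as an integral over the line. -/
theorem InnerProductSpace.HarmonicOnNhd.eq_integral_horocircle {f : ℂ → ℝ}
    (hf : InnerProductSpace.HarmonicOnNhd f {z : ℂ | 0 < z.im}) {δ x u R : ℝ} (hδ : 0 < δ)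
    (hu : 0 < u) (hR : (x ^ 2 + u ^ 2) / u ≤ R) :
    f (x + (u + δ : ℝ) * Complex.I) = ∫ t, (Set.Ioc (-(Real.pi * R)) (Real.pi * R)).indicator
      (fun t => (2 * u - (x ^ 2 + u ^ 2) / R) / (2 * Real.pi *
        ‖horocircle δ R t - (x + (u + δ : ℝ) * Complex.I)‖ ^ 2) * f (horocircle δ R t)) t := by
  have hR' : x ^ 2 + u ^ 2 ≤ R * u := by rwa [div_le_iff₀ hu] at hR
  have hR0 : 0 < R := by nlinarith [sq_nonneg x, sq_pos_of_pos hu]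
  set c : ℂ := (R + δ : ℝ) * Complex.I with hc
  set w : ℂ := x + (u + δ : ℝ) * Complex.I with hw
  have hwc : ‖w - c‖ ^ 2 = x ^ 2 + (u - R) ^ 2 := by
    have : w - c = x + (u - R : ℝ) * Complex.I := by rw [hw, hc]; push_cast; ring
    rw [this, Complex.norm_add_mul_I, Real.sq_sqrt (by positivity)]
  have hsub : Metric.closedBall c R ⊆ {z : ℂ | 0 < z.im} := by
    intro z hz
    have h1 : |z.im - c.im| ≤ R := by
      rw [← Complex.sub_im]
      exact (Complex.abs_im_le_norm _).trans (by simpa [dist_eq_norm] using hz)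
    have h2 : c.im = R + δ := by simp [hc]
    rw [h2, abs_le] at h1
    simp only [Set.mem_ofPred_eq]
    linarith [h1.1]
  have hwb : w ∈ Metric.ball c R := by
    rw [Metric.mem_ball, dist_eq_norm]
    apply lt_of_pow_lt_pow_left₀ 2 hR0.le
    rw [hwc]; nlinarith
  have hP := InnerProductSpace.HarmonicOnNhd.circleAverage_poissonKernel_smul (hf.mono hsub) hwb
  rw [Real.circleAverage_eq_integral_neg_pi_pi _ _ _ (-(Real.pi / 2))] at hP
  have hsubst := intervalIntegral.integral_comp_div (a := -(Real.pi * R)) (b := Real.pi * R)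
    (fun θ => (poissonKernel c w • f) (circleMap c R (θ + -(Real.pi / 2)))) hR0.ne'
  have e1 : -(Real.pi * R) / R = -Real.pi := by field_simp
  have e2 : Real.pi * R / R = Real.pi := by field_simp
  rw [e1, e2] at hsubst
  have hle : -(Real.pi * R) ≤ Real.pi * R := by nlinarith [Real.pi_pos, mul_pos Real.pi_pos hR0]
  rw [integral_indicator measurableSet_Ioc, ← intervalIntegral.integral_of_le hle, ← hP]
  have hI : ∫ θ in (-Real.pi)..Real.pi,
      (poissonKernel c w • f) (circleMap c R (θ + -(Real.pi / 2))) = R⁻¹ •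
      ∫ t in (-(Real.pi * R))..(Real.pi * R), poissonKernel c w (horocircle δ R t) *
        f (horocircle δ R t) := by
    rw [eq_inv_smul_iff₀ hR0.ne', ← hsubst]
    congr with t
    rw [hc, circleMap_eq_horocircle]
    rfl
  rw [hI, smul_smul, ← intervalIntegral.integral_smul]
  congr with t
  have hnum : ‖horocircle δ R t - c‖ = R := by
    rw [hc, ← circleMap_eq_horocircle, circleMap_sub_center, norm_circleMap_zero, abs_of_pos hR0]
  rw [poissonKernel_def, hnum, hwc, sub_sub_sub_cancel_right, smul_eq_mul, ← mul_assoc]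
  congr 1
  have : R ^ 2 - (x ^ 2 + (u - R) ^ 2) = R * (2 * u - (x ^ 2 + u ^ 2) / R) := by
    field_simp; ring
  rw [this]
  field_simp

/-- The real case of the Poisson formula above height `δ`: in the formula for the discs tangent to
the line at height `δ`, the radius tends to infinity under the integral sign. -/
theorem InnerProductSpace.HarmonicOnNhd.eq_integral_halfPlanePoissonKernel_mul {f : ℂ → ℝ}
    (hf : InnerProductSpace.HarmonicOnNhd f {z : ℂ | 0 < z.im}) {δ M : ℝ} (hδ : 0 < δ)
    (hM : ∀ z : ℂ, δ ≤ z.im → ‖f z‖ ≤ M) (x : ℝ) {u : ℝ} (hu : 0 < u) :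
    f (x + (u + δ : ℝ) * Complex.I) =
      ∫ t : ℝ, halfPlanePoissonKernel u (x - t) * f (t + δ * Complex.I) := by
  set w : ℂ := x + (u + δ : ℝ) * Complex.I with hw
  set B := 4 / u ^ 2 + (Real.pi / 2 * (1 + 2 * ‖(x + u * Complex.I : ℂ)‖ / u)) ^ 2 with hB
  have hB0 : 0 ≤ B := by positivity
  have hM0 : 0 ≤ M := (norm_nonneg _).trans (hM (δ * Complex.I) (by simp))
  set R₀ := (x ^ 2 + u ^ 2) / u with hR₀
  have hR₀0 : 0 < R₀ := by positivity
  have hfc (R : ℝ) (hR : 0 < R) : Continuous fun t => f (horocircle δ R t) :=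
    hf.continuousOn.comp_continuous (continuous_horocircle δ R)
      fun t => hδ.trans_le (le_horocircle_im δ hR.le t)
  have key : Tendsto (fun R => ∫ t, (Set.Ioc (-(Real.pi * R)) (Real.pi * R)).indicator
      (fun t => (2 * u - (x ^ 2 + u ^ 2) / R) / (2 * Real.pi *
        ‖horocircle δ R t - w‖ ^ 2) * f (horocircle δ R t)) t) atTop
      (𝓝 (∫ t : ℝ, halfPlanePoissonKernel u (x - t) * f (t + δ * Complex.I))) := by
    refine tendsto_integral_filter_of_dominated_convergence
      (fun t => 2 * u / (2 * Real.pi) * B * M * (1 + t ^ 2)⁻¹) ?_ ?_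
      (integrable_inv_one_add_sq.const_mul _) (.of_forall fun t => ?_)
    · filter_upwards [eventually_ge_atTop R₀] with R hR
      have h1 := (hfc R (hR₀0.trans_le hR)).measurable
      have h2 := (continuous_horocircle δ R).measurable
      have h3 : Measurable fun t => ‖horocircle δ R t - w‖ := (h2.sub_const w).norm
      exact ((((h3.pow_const 2).const_mul _).const_div _).mul h1 |>.indicator
        measurableSet_Ioc).aestronglyMeasurable
    · filter_upwards [eventually_ge_atTop R₀] with R hR
      refine .of_forall fun t => ?_
      have hR0 := hR₀0.trans_le hR
      by_cases ht : t ∈ Set.Ioc (-(Real.pi * R)) (Real.pi * R)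
      · rw [Set.indicator_of_mem ht]
        have hlow := one_add_sq_le_mul_norm_horocircle_sub_sq (δ := δ) hu hR
          (abs_le.2 ⟨ht.1.le, ht.2⟩)
        rw [← hw, ← hB] at hlow
        set D := ‖horocircle δ R t - w‖ ^ 2 with hD
        have hD0 : 0 < D := by
          rcases (sq_nonneg ‖horocircle δ R t - w‖).eq_or_lt with h | h
          · rw [← h] at hD
            rw [hD] at hlow
            nlinarith [sq_nonneg t]
          · exact h
        have hnum0 : 0 ≤ 2 * u - (x ^ 2 + u ^ 2) / R := by
          have : (x ^ 2 + u ^ 2) / R ≤ u := by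
            rw [div_le_iff₀ hR0]
            rw [hR₀, div_le_iff₀ hu] at hR
            linarith
          linarith
        have hnum1 : 2 * u - (x ^ 2 + u ^ 2) / R ≤ 2 * u := by
          have : 0 ≤ (x ^ 2 + u ^ 2) / R := by positivity
          linarith
        have hinv : D⁻¹ ≤ B * (1 + t ^ 2)⁻¹ := by
          rw [← div_eq_mul_inv, le_div_iff₀ (by positivity), inv_mul_le_iff₀ hD0, mul_comm D]
          exact hlow
        rw [norm_mul, Real.norm_of_nonneg (by positivity)]
        calc (2 * u - (x ^ 2 + u ^ 2) / R) / (2 * Real.pi * D) * ‖f (horocircle δ R t)‖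
            ≤ (2 * u) / (2 * Real.pi * D) * M := by
              gcongr
              exact hM _ (le_horocircle_im δ hR0.le t)
          _ = 2 * u / (2 * Real.pi) * D⁻¹ * M := by field_simp
          _ ≤ 2 * u / (2 * Real.pi) * (B * (1 + t ^ 2)⁻¹) * M := by gcongr
          _ = _ := by ring
      · rw [Set.indicator_of_notMem ht, norm_zero]
        positivity
    · have hz := tendsto_horocircle δ t
      have hdist : ‖(t + δ * Complex.I : ℂ) - w‖ ^ 2 = u ^ 2 + (x - t) ^ 2 := by
        have : (t + δ * Complex.I : ℂ) - w = (t - x : ℝ) + (-u : ℝ) * Complex.I := by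
          rw [hw]; push_cast; ring
        rw [this, Complex.norm_add_mul_I, Real.sq_sqrt (by positivity)]
        ring
      have hlim : Tendsto (fun R => (2 * u - (x ^ 2 + u ^ 2) / R) / (2 * Real.pi *
          ‖horocircle δ R t - w‖ ^ 2) * f (horocircle δ R t)) atTop
          (𝓝 ((2 * u - 0) / (2 * Real.pi * ‖(t + δ * Complex.I : ℂ) - w‖ ^ 2) *
            f (t + δ * Complex.I))) := by
        have hcont : ContinuousAt f (t + δ * Complex.I) :=
          (hf _ (by simpa using hδ)).1.continuousAt
        refine Tendsto.mul (Tendsto.div ?_ ?_ ?_) (hcont.tendsto.comp hz)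
        · exact (tendsto_const_nhds.div_atTop tendsto_id).const_sub _
        · exact (((hz.sub_const w).norm).pow 2).const_mul _
        · rw [hdist]; positivity
      have hval : (2 * u - 0) / (2 * Real.pi * ‖(t + δ * Complex.I : ℂ) - w‖ ^ 2) =
          halfPlanePoissonKernel u (x - t) := by
        rw [hdist, halfPlanePoissonKernel, sub_zero, mul_assoc, mul_div_mul_left _ _ two_ne_zero]
      rw [hval] at hlim
      refine hlim.congr' ?_
      filter_upwards [eventually_gt_atTop |t|] with R hR
      rw [Set.indicator_of_mem]
      have h1 : |t| < Real.pi * R := by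
        nlinarith [Real.pi_gt_three, abs_nonneg t]
      exact ⟨(abs_lt.1 h1).1, (abs_lt.1 h1).2.le⟩
  refine tendsto_nhds_unique (tendsto_const_nhds.congr' ?_) key
  filter_upwards [eventually_ge_atTop R₀] with R hR
  exact hf.eq_integral_horocircle hδ hu hR

/-- A harmonic function on the upper half plane which is bounded above height `δ` is there the
Poisson integral of its values at height `δ`. -/
theorem InnerProductSpace.HarmonicOnNhd.eq_integral_halfPlanePoissonKernel_smul {F : ℂ → ℂ}
    (hF : InnerProductSpace.HarmonicOnNhd F {z : ℂ | 0 < z.im}) {δ M : ℝ} (hδ : 0 < δ)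
    (hM : ∀ z : ℂ, δ ≤ z.im → ‖F z‖ ≤ M) (x : ℝ) {u : ℝ} (hu : 0 < u) :
    F (x + (u + δ : ℝ) * Complex.I) =
      ∫ t : ℝ, halfPlanePoissonKernel u (x - t) • F (t + δ * Complex.I) := by
  have hcont : Continuous fun t : ℝ => F (t + δ * Complex.I) :=
    hF.continuousOn.comp_continuous (by fun_prop) fun t => by simpa using hδ
  have hker : Integrable fun t => halfPlanePoissonKernel u (x - t) :=
    (integrable_halfPlanePoissonKernel 0 hu).comp_sub_left x |>.congr (.of_forall fun t => by simp)
  have hint : Integrable fun t : ℝ => halfPlanePoissonKernel u (x - t) • F (t + δ * Complex.I) := by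
    refine (hker.norm.mul_const M).mono' (hker.1.smul hcont.aestronglyMeasurable)
      (.of_forall fun t => ?_)
    rw [norm_smul]
    gcongr
    exact hM _ (by simp)
  apply Complex.ext
  · have h := (hF.comp_CLM Complex.reCLM).eq_integral_halfPlanePoissonKernel_mul hδ
      (fun z hz => (Complex.abs_re_le_norm _).trans (hM z hz)) x hu
    refine h.trans (Eq.trans ?_ (integral_re hint))
    simp
  · have h := (hF.comp_CLM Complex.imCLM).eq_integral_halfPlanePoissonKernel_mul hδ
      (fun z hz => (Complex.abs_im_le_norm _).trans (hM z hz)) x hu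
    refine h.trans (Eq.trans ?_ (integral_im hint))
    simp

/-! ### The representing measure -/

/-- The representing measure is a weak limit of the measures `F(t + i δ) dt` as `δ → 0`. -/
theorem InnerProductSpace.HarmonicOnNhd.exists_isPoissonIntegralOf {F : ℂ → ℂ}
    (hF : InnerProductSpace.HarmonicOnNhd F {z : ℂ | 0 < z.im}) {K : ℝ≥0}
    (hK : ∀ u : ℝ, 0 < u → heightL1Norm F u ≤ K) :
    ∃ μ : ComplexMeasure ℝ, IsPoissonIntegralOf F μ := by
  set δ : ℕ → ℝ := fun n => 1 / ((n : ℝ) + 1) with hδ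
  have hδ0 (n : ℕ) : 0 < δ n := Nat.one_div_pos_of_nat
  obtain ⟨μ, hμ⟩ := exists_complexMeasure_tendsto_integral_smul (Ultrafilter.of atTop)
    (f := fun (n : ℕ) (t : ℝ) => F (t + δ n * Complex.I)) (fun n => by
      refine Continuous.measurable ?_
      exact hF.continuousOn.comp_continuous (by fun_prop) fun t => by simpa using hδ0 n)
    (fun n => hK _ (hδ0 n))
  refine ⟨μ, fun x u hu => ?_⟩
  -- the kernel decays like `(1 + t²)⁻¹`; the constant comes from `t² ≤ 2 x² + 2 (x - t)²`
  have hbd (t : ℝ) : |halfPlanePoissonKernel u (x - t)| * (1 + t ^ 2) ≤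
      (u / Real.pi) * ((1 + 2 * x ^ 2) / u ^ 2 + 2) := by
    rw [abs_of_nonneg (halfPlanePoissonKernel_nonneg hu _), halfPlanePoissonKernel,
      ← div_div, div_mul_eq_mul_div, mul_div_assoc]
    gcongr
    rw [div_le_iff₀ (by positivity)]
    have e : ((1 + 2 * x ^ 2) / u ^ 2 + 2) * (u ^ 2 + (x - t) ^ 2) =
        (1 + 2 * x ^ 2) + 2 * u ^ 2 + (1 + 2 * x ^ 2) / u ^ 2 * (x - t) ^ 2 + 2 * (x - t) ^ 2 := by
      field_simp; ring
    have e2 : 0 ≤ (1 + 2 * x ^ 2) / u ^ 2 * (x - t) ^ 2 := by positivity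
    nlinarith [sq_nonneg (2 * x - t), sq_nonneg u]
  have h1 := hμ (fun t => halfPlanePoissonKernel u (x - t))
    ((continuous_halfPlanePoissonKernel hu).comp (by fun_prop)) _ hbd
  have h2 : Tendsto (fun n : ℕ => F (x + (u + δ n : ℝ) * Complex.I))
      (Ultrafilter.of (atTop : Filter ℕ) : Filter ℕ)
      (𝓝 (F (x + u * Complex.I))) := by
    have hcont : ContinuousAt F (x + u * Complex.I) := (hF _ (by simpa using hu)).1.continuousAt
    have h3 : Tendsto (fun n : ℕ => (x + (u + δ n : ℝ) * Complex.I : ℂ)) atTop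
        (𝓝 (x + u * Complex.I)) := by
      have h4 : Continuous fun d : ℝ => (x + (u + d : ℝ) * Complex.I : ℂ) := by fun_prop
      have h5 := (h4.tendsto 0).comp (tendsto_one_div_add_atTop_nhds_zero_nat (𝕜 := ℝ))
      simpa [Function.comp_def, hδ] using h5
    exact (hcont.tendsto.comp h3).mono_left (Ultrafilter.of_le _)
  refine tendsto_nhds_unique h2 (h1.congr fun n => ?_)
  refine (hF.eq_integral_halfPlanePoissonKernel_smul (M := 4 * K / (Real.pi * δ n)) (hδ0 n)
    (fun z hz => ?_) x hu).symm
  have hz0 := (hδ0 n).trans_le hz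
  refine (hF.norm_le_of_heightL1Norm_le hK hz0).trans ?_
  have := hδ0 n
  gcongr

theorem theorem2p5 (F : ℂ → ℂ)
    (hF : InnerProductSpace.HarmonicOnNhd F {z : ℂ | 0 < z.im}) :
    -- existence of a unique representing measure is equivalent to boundedness of the `L¹` norms
    ((∃! μ : ComplexMeasure ℝ, IsPoissonIntegralOf F μ) ↔
      ∃ K : ℝ≥0, ∀ u : ℝ, 0 < u → heightL1Norm F u ≤ K) ∧
    -- a representing measure is always unique (whether or not boundedness is assumed)
    (∀ μ ν : ComplexMeasure ℝ, IsPoissonIntegralOf F μ → IsPoissonIntegralOf F ν → μ = ν) ∧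
    -- the total variation norm of the representing measure is finite, and is the limit
    (∀ μ : ComplexMeasure ℝ, IsPoissonIntegralOf F μ →
      μ.variation Set.univ < ∞ ∧
      Tendsto (heightL1Norm F) (𝓝[>] 0) (𝓝 (μ.variation Set.univ))) := by
  have hfin (μ : ComplexMeasure ℝ) : μ.variation Set.univ < ∞ :=
    (ComplexMeasure.isFiniteMeasure_variation μ).measure_univ_lt_top
  refine ⟨⟨?_, ?_⟩, fun μ ν hμ hν => hμ.unique hν, fun μ hμ => ⟨hfin μ, hμ.tendsto_heightL1Norm⟩⟩
  · rintro ⟨μ, hμ, -⟩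
    refine ⟨(μ.variation Set.univ).toNNReal, fun u hu => ?_⟩
    rw [ENNReal.coe_toNNReal (hfin μ).ne]
    exact hμ.heightL1Norm_le hu
  · rintro ⟨K, hK⟩
    obtain ⟨μ, hμ⟩ := hF.exists_isPoissonIntegralOf hK
    exact ⟨μ, hμ, fun ν hν => hν.unique hμ⟩
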